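/- Let $B$ be a complete unital commutative normed algebra over $\mathbb{Q}$ (with submultiplicative norm) such that $\|a^2\|=\|a\|^2$ and $\|a^2\|\le\|a^2+b^2\|$ for all $a,b\in B$. A nonnegative upper real is an inhabited, open, upward closed set $U$ of positive rationals, where $r\in U$ is read as "$U<r$"; the norm $\|a\|$ is identified with $\{r\in\mathbb{Q}_{>0} : \|a\|<r\}$. For a rational $r$ and $a\in B$, write $r\ll a$ if $a-s$ is a square in $B$ for some rational $s>r$. Let $\|a\|_0$ be given by: $\|a\|_0<r$ iff $0\ll r-a$ and $0\ll r+a$ ($r\in\mathbb{Q}_{>0}$). Let $\mathrm{MFn}(B)$ be the locale generated by symbols $D(a)$, $a\in B$, and the relations $D(1)=1$; $D(-a^2)=0$; $D(a+b)\le D(a)\vee D(b)$; $D(a)\wedge D(-a)=0$; $D(ab)=(D(a)\wedge D(b))\vee(D(-a)\wedge D(-b))$; $D(a)=\bigvee_{r\in\mathbb{Q},\,r>0}D(a-r)$. The Gelfand transform of $a$ is the map of locales $\hat a:\mathrm{MFn}(B)\to\mathbb{R}$ with $\hat a^{-1}(r,s)=D(a-r)\wedge D(s-a)$ for rational $r,s$,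 and $\|\hat a\|$ is given by: $\|\hat a\|<r$ iff $\hat a^{-1}(-r,r)=D(r-a)\wedge D(a+r)=1$ ($r\in\mathbb{Q}_{>0}$). Then the Gelfand transform is norm-preserving: for every $a\in B$, $\|a\|_0$ and $\|\hat a\|$ are nonnegative upper reals, and $$\|a\|_0=\|a\|=\|\hat a\| .$$ -/

import Mathlib

open TopologicalSpace

namespace GelfandReal

universe u v

/-! ### Nonnegative upper reals -/

/-- A nonnegative upper real: an inhabited, open, upward closed set of positive rationals.
The rational `r` belongs to the set `U` when the upper real is `< r`. -/
structure IsNonnegUpperReal (U : Set ℚ) : Prop where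
  pos : ∀ r ∈ U, 0 < r
  nonempty : U.Nonempty
  upward : ∀ r ∈ U, ∀ s, r ≤ s → s ∈ U
  isOpen : ∀ r ∈ U, ∃ s ∈ U, s < r

/-- The upper real given by the norm of `a`. -/
def normCut {B : Type u} [NormedCommRing B] (a : B) : Set ℚ :=
  {r | 0 < r ∧ ‖a‖ < (r : ℝ)}

/-! ### The ordering by squares and the order-unit seminorm -/

/-- The relation `r ≪ a`: `a - s` is a square for some rational `s > r`. -/
def WayBelow {B : Type u} [CommRing B] [Algebra ℚ B] (r : ℚ) (a : B) : Prop :=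
  ∃ s : ℚ, r < s ∧ IsSquare (a - algebraMap ℚ B s)

/-- The upper real `‖a‖₀`: `‖a‖₀ < r` iff `0 ≪ r - a` and `0 ≪ r + a`. -/
def orderUnitCut {B : Type u} [CommRing B] [Algebra ℚ B] (a : B) : Set ℚ :=
  {r | 0 < r ∧ WayBelow 0 (algebraMap ℚ B r - a) ∧ WayBelow 0 (algebraMap ℚ B r + a)}

/-! ### Frames by generators and relations -/

/-- The free frame on a set `G` of generators: families of finite subsets of `G` closed under
supersets (a finite set stands for the meet of its elements, a family for the join of its
members). -/
abbrev FreeFrame (G : Type u) : Type u := LowerSet (Finset G)ᵒᵈ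

/-- The generator `g` in the free frame: all finite sets containing `g`. -/
def gen {G : Type u} (g : G) : FreeFrame G where
  carrier := {s | g ∈ OrderDual.ofDual s}
  lower' := fun _ _ hst hs => (OrderDual.ofDual_le_ofDual.2 hst) hs

/-- The quotient of a frame by a set of relations `x = y`, realised as the sublocale of the
elements that do not distinguish `x` from `y` for any relation `(x, y)`. -/
def relSublocale {F : Type u} [Order.Frame F] (R : F → F → Prop) : Sublocale F where
  carrier := {w | ∀ x y, R x y → ∀ z, x ⊓ z ≤ w ↔ y ⊓ z ≤ w}
  sInf_mem' := by
    intro S hS x y hxy z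
    simp only [le_sInf_iff]
    exact forall₂_congr fun w hw => hS hw x y hxy z
  himp_mem' := by
    intro a b hb x y hxy z
    rw [le_himp_iff, le_himp_iff, inf_assoc, inf_assoc]
    exact hb x y hxy (z ⊓ a)

lemma relSublocale_restrict_eq {F : Type u} [Order.Frame F] (R : F → F → Prop) {x y : F}
    (h : R x y) : (relSublocale R).restrict x = (relSublocale R).restrict y := by
  refine eq_of_forall_ge_iff fun w => ?_
  have gc := (relSublocale R).giRestrict.gc
  have hw := w.2 x y h ⊤
  rw [inf_top_eq, inf_top_eq] at hw
  exact (gc x w).trans (hw.trans (gc y w).symm)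

lemma eq_sSup_gen {G : Type u} (U : FreeFrame G) :
    U = ⨆ s ∈ U, (OrderDual.ofDual s).inf gen := by
  classical
  have hmem : ∀ s t : (Finset G)ᵒᵈ, t ∈ (OrderDual.ofDual s).inf (gen (G := G)) ↔ t ≤ s := by
    intro s t
    rw [← LowerSet.Iic_le, Finset.le_inf_iff]
    simp only [LowerSet.Iic_le]
    exact Iff.rfl
  ext t
  simp only [SetLike.mem_coe, LowerSet.mem_iSup_iff, hmem]
  exact ⟨fun h => ⟨t, h, le_rfl⟩, fun ⟨s, hs, hts⟩ => U.lower hts hs⟩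

/-- Every map from the generators to a frame extends to the free frame. -/
lemma exists_freeLift {G : Type u} {L : Type v} [Order.Frame L] (d : G → L) :
    ∃ φ : FrameHom (FreeFrame G) L, ∀ g, φ (gen g) = d g := by
  classical
  have hmono : ∀ s t : (Finset G)ᵒᵈ, s ≤ t →
      (OrderDual.ofDual s).inf d ≤ (OrderDual.ofDual t).inf d :=
    fun s t h => Finset.inf_mono (OrderDual.ofDual_le_ofDual.2 h)
  refine ⟨{ toFun := fun U => ⨆ s ∈ U, (OrderDual.ofDual s).inf d
            map_inf' := ?_, map_top' := ?_, map_sSup' := ?_ }, ?_⟩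
  · intro U V
    refine le_antisymm (le_inf (iSup₂_le fun s hs => ?_) (iSup₂_le fun s hs => ?_)) ?_
    · exact le_iSup₂_of_le s hs.1 le_rfl
    · exact le_iSup₂_of_le s hs.2 le_rfl
    · rw [iSup₂_inf_eq]
      refine iSup₂_le fun s hs => ?_
      rw [inf_iSup₂_eq]
      refine iSup₂_le fun t ht => ?_
      refine le_iSup₂_of_le (OrderDual.toDual (OrderDual.ofDual s ∪ OrderDual.ofDual t))
        ⟨?_, ?_⟩ ?_
      · exact U.lower (a := s) Finset.subset_union_left hs
      · exact V.lower (a := t) Finset.subset_union_right ht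
      · exact (Finset.inf_union (f := d)).ge
  · exact top_le_iff.1 (le_iSup₂_of_le (OrderDual.toDual ∅) trivial le_rfl)
  · intro S
    refine le_antisymm (iSup₂_le fun s hs => ?_) (sSup_le ?_)
    · obtain ⟨U, hU, hsU⟩ := LowerSet.mem_sSup_iff.1 hs
      exact le_sSup_of_le ⟨U, hU, rfl⟩ (le_iSup₂_of_le s hsU le_rfl)
    · rintro _ ⟨U, hU, rfl⟩
      exact iSup₂_le fun s hs => le_iSup₂_of_le s (LowerSet.mem_sSup_iff.2 ⟨U, hU, hs⟩) le_rfl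
  · intro g
    refine le_antisymm (iSup₂_le fun s hs => Finset.inf_le hs) ?_
    exact le_iSup₂_of_le (OrderDual.toDual {g}) (Finset.mem_singleton_self g)
      (Finset.inf_singleton (f := d) (b := g)).ge

/-! ### The locale of multiplicative functionals -/

/-- The defining relations between the symbols `D(a)`. -/
inductive MFnRel (B : Type u) [CommRing B] [Algebra ℚ B] : FreeFrame B → FreeFrame B → Prop
  | one : MFnRel B (gen 1) ⊤
  | neg_sq (a : B) : MFnRel B (gen (-a ^ 2)) ⊥
  | add (a b : B) : MFnRel B (gen (a + b) ⊔ (gen a ⊔ gen b)) (gen a ⊔ gen b)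
  | inf_neg (a : B) : MFnRel B (gen a ⊓ gen (-a)) ⊥
  | mul (a b : B) : MFnRel B (gen (a * b)) ((gen a ⊓ gen b) ⊔ (gen (-a) ⊓ gen (-b)))
  | iSup (a : B) : MFnRel B (gen a) (⨆ r : {r : ℚ // 0 < r}, gen (a - algebraMap ℚ B r))

/-- The frame of opens of the locale `MFn(B)`, generated by symbols `D(a)`, `a ∈ B`, subject to
`MFnRel`. -/
def MFn (B : Type u) [CommRing B] [Algebra ℚ B] : Type u := relSublocale (MFnRel B)

instance (B : Type u) [CommRing B] [Algebra ℚ B] : Order.Frame (MFn B) :=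
  inferInstanceAs (Order.Frame (relSublocale (MFnRel B)))

/-- The quotient map from the free frame to `MFn(B)`. -/
def quot (B : Type u) [CommRing B] [Algebra ℚ B] : FrameHom (FreeFrame B) (MFn B) :=
  (relSublocale (MFnRel B)).restrict

/-- The generator `D(a)` of `MFn(B)`. -/
def D {B : Type u} [CommRing B] [Algebra ℚ B] (a : B) : MFn B :=
  quot B (gen a)

/-- The six relations, for a map `d` from `B` to a frame. -/
structure IsMFnModel {B : Type u} [CommRing B] [Algebra ℚ B] {L : Type v} [Order.Frame L]
    (d : B → L) : Prop where
  one : d 1 = ⊤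
  neg_sq : ∀ a, d (-a ^ 2) = ⊥
  add : ∀ a b, d (a + b) ≤ d a ⊔ d b
  inf_neg : ∀ a, d a ⊓ d (-a) = ⊥
  mul : ∀ a b, d (a * b) = (d a ⊓ d b) ⊔ (d (-a) ⊓ d (-b))
  iSup : ∀ a, d a = ⨆ r : {r : ℚ // 0 < r}, d (a - algebraMap ℚ B r)

section Presentation

variable {B : Type u} [CommRing B] [Algebra ℚ B]

lemma quot_eq {x y : FreeFrame B} (h : MFnRel B x y) : quot B x = quot B y :=
  relSublocale_restrict_eq _ h

theorem isMFnModel_D : IsMFnModel (D : B → MFn B) where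
  one := (quot_eq MFnRel.one).trans (map_top _)
  neg_sq a := (quot_eq (MFnRel.neg_sq a)).trans (map_bot _)
  add a b := by
    have h := quot_eq (MFnRel.add a b)
    simp only [map_sup] at h
    exact sup_eq_right.1 h
  inf_neg a := by
    have h := quot_eq (MFnRel.inf_neg a)
    simp only [map_inf, map_bot] at h
    exact h
  mul a b := by
    have h := quot_eq (MFnRel.mul a b)
    simp only [map_inf, map_sup] at h
    exact h
  iSup a := by
    have h := quot_eq (MFnRel.iSup a)
    simp only [map_iSup] at h
    exact h

/-- `MFn(B)` is the frame presented by the six relations: every map from `B` to a frame that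
satisfies them factors uniquely through `D` by a frame homomorphism. -/
theorem existsUnique_frameHom {L : Type v} [Order.Frame L] {d : B → L} (hd : IsMFnModel d) :
    ∃! f : FrameHom (MFn B) L, ∀ a, f (D a) = d a := by
  classical
  obtain ⟨φ, hφ⟩ := exists_freeLift d
  have hrel : ∀ x y, MFnRel B x y → φ x = φ y := by
    intro x y h
    induction h with
    | one => rw [hφ, hd.one, map_top]
    | neg_sq a => rw [hφ, hd.neg_sq, map_bot]
    | add a b => simp only [map_sup, hφ]; exact sup_eq_right.2 (hd.add a b)
    | inf_neg a => simp only [map_inf, map_bot, hφ]; exact hd.inf_neg a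
    | mul a b => simp only [map_inf, map_sup, hφ]; exact hd.mul a b
    | iSup a => simp only [map_iSup, hφ]; exact hd.iSup a
  have hclos : ∀ x, φ (quot B x).1 = φ x := by
    intro x
    refine le_antisymm ?_ (OrderHomClass.mono φ
      ((relSublocale (MFnRel B)).giRestrict.gc.le_u_l x))
    have hW : ∀ V, V ≤ sSup {V | φ V ≤ φ x} ↔ φ V ≤ φ x := by
      intro V
      refine ⟨fun h => (OrderHomClass.mono φ h).trans ?_, fun h => le_sSup h⟩
      rw [map_sSup]
      exact sSup_le (by rintro _ ⟨U, hU, rfl⟩; exact hU)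
    have hmem : sSup {V | φ V ≤ φ x} ∈ relSublocale (MFnRel B) := by
      intro p q hpq z
      rw [hW, hW, map_inf, map_inf, hrel p q hpq]
    have h1 : quot B x ≤ (⟨_, hmem⟩ : relSublocale (MFnRel B)) :=
      ((relSublocale (MFnRel B)).giRestrict.gc x _).2 ((hW x).2 le_rfl)
    exact (hW _).1 h1
  have hsurj : ∀ w : MFn B, quot B w.1 = w := fun w =>
    (relSublocale (MFnRel B)).giRestrict.l_u_eq w
  refine ⟨{ toFun := fun w => φ w.1, map_inf' := ?_, map_top' := ?_, map_sSup' := ?_ }, ?_, ?_⟩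
  · intro v w
    exact map_inf φ v.1 w.1
  · exact map_top φ
  · intro S
    have h1 : sSup S = quot B (sSup ((fun w : MFn B => w.1) '' S)) := by
      rw [map_sSup, Set.image_image]
      simp only [hsurj, Set.image_id']
    change φ (sSup S : MFn B).1 = _
    rw [h1, hclos, map_sSup, Set.image_image]
  · intro a
    exact (hclos _).trans (hφ a)
  · intro f hf
    have h2 : ∀ U, f (quot B U) = φ U := by
      intro U
      rw [eq_sSup_gen U]
      simp only [map_iSup, map_finset_inf]
      refine iSup_congr fun s => iSup_congr fun _ => Finset.inf_congr rfl fun g _ => ?_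
      exact (hf g).trans (hφ g).symm
    ext w
    change f w = φ w.1
    rw [← h2, hsurj]

end Presentation

/-! ### The Gelfand transform -/

section Transform

variable {B : Type u} [NormedCommRing B] [NormedAlgebra ℚ B]

/-- The inverse image of an open set of reals under `â`: the join of the opens
`D(a - r) ∧ D(s - a)` over the rational intervals `[r, s]` contained in it. -/
def gelfandPreimage (a : B) (U : Opens ℝ) : MFn B :=
  ⨆ p : {p : ℚ × ℚ // Set.Icc (p.1 : ℝ) p.2 ⊆ U},
    D (a - algebraMap ℚ B p.1.1) ⊓ D (algebraMap ℚ B p.1.2 - a)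

lemma D_mono {a b : B} (h : IsSquare (b - a)) : D a ≤ D b := by
  obtain ⟨y, hy⟩ := h
  have h1 := isMFnModel_D.add b (-y ^ 2)
  rw [isMFnModel_D.neg_sq, sup_bot_eq] at h1
  have : b + -y ^ 2 = a := by linear_combination hy
  rwa [this] at h1

lemma D_pos {q : ℚ} (hq : 0 < q) : D (algebraMap ℚ B q) = ⊤ := by
  have hneg : ∀ n : ℕ, D (-((n : B) + 1)) = ⊥ := by
    have h1 : D (-(1 : B)) = ⊥ := by
      have h := isMFnModel_D.inf_neg (1 : B)
      rwa [isMFnModel_D.one, top_inf_eq] at h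
    intro n
    induction n with
    | zero => simpa using h1
    | succ k ih =>
      have h := isMFnModel_D.add (-((k : B) + 1)) (-1)
      rw [ih, h1, sup_bot_eq, le_bot_iff] at h
      rw [← h]
      congr 1
      push_cast
      ring
  have hinv : ∀ n : ℕ, D ((n : B) + 1) = ⊤ ∧ D (algebraMap ℚ B ((n : ℚ) + 1)⁻¹) = ⊤ := by
    intro n
    have h := isMFnModel_D.mul ((n : B) + 1) (algebraMap ℚ B ((n : ℚ) + 1)⁻¹)
    have h2 : ((n : B) + 1) * algebraMap ℚ B ((n : ℚ) + 1)⁻¹ = 1 := by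
      have h3 : ((n : B) + 1) = algebraMap ℚ B ((n : ℚ) + 1) := by simp
      rw [h3, ← map_mul, mul_inv_cancel₀ (by positivity), map_one]
    rw [h2, isMFnModel_D.one, hneg, bot_inf_eq, sup_bot_eq] at h
    exact inf_eq_top_iff.1 h.symm
  obtain ⟨m, hm⟩ : ∃ m : ℕ, q.num = (m : ℤ) + 1 :=
    ⟨(q.num - 1).toNat, by have := Rat.num_pos.2 hq; omega⟩
  obtain ⟨n, hn⟩ : ∃ n : ℕ, q.den = n + 1 := ⟨q.den - 1, by have := q.den_pos; omega⟩
  have hq' : algebraMap ℚ B q = ((m : B) + 1) * algebraMap ℚ B ((n : ℚ) + 1)⁻¹ := by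
    have h3 : ((m : B) + 1) = algebraMap ℚ B ((m : ℚ) + 1) := by simp
    rw [h3, ← map_mul]
    congr 1
    rw [← div_eq_mul_inv]
    conv_lhs => rw [← Rat.num_div_den q, hm, hn]
    push_cast
    rfl
  rw [hq', isMFnModel_D.mul, (hinv m).1, (hinv n).2, top_inf_eq, top_sup_eq]

lemma D_le_of_rat {a : B} {r s : ℚ} (h : r ≤ s) :
    D (a + algebraMap ℚ B r) ≤ D (a + algebraMap ℚ B s) := by
  rcases h.eq_or_lt with rfl | h
  · exact le_rfl
  · have h1 := isMFnModel_D.inf_neg (algebraMap ℚ B (s - r))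
    rw [D_pos (sub_pos.2 h), top_inf_eq] at h1
    have h2 := isMFnModel_D.add (a + algebraMap ℚ B s) (-algebraMap ℚ B (s - r))
    rw [h1, sup_bot_eq] at h2
    convert h2 using 2
    rw [map_sub]
    ring

lemma exists_sq [CompleteSpace B] (x : B) (h : ‖x‖ ≤ 1 / 2) : IsSquare (1 - x) := by
  have hhalf : ∀ b : B, ‖(1 / 2 : ℚ) • b‖ ≤ 1 / 2 * ‖b‖ := fun b => by
    refine (norm_smul_le _ _).trans_eq ?_
    rw [← Rat.norm_cast_real]
    norm_num
  let f : B → B := fun y => (1 / 2 : ℚ) • (x + y ^ 2)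
  have hmaps : Set.MapsTo f (Metric.closedBall 0 (1 / 2)) (Metric.closedBall 0 (1 / 2)) := by
    intro y hy
    rw [mem_closedBall_zero_iff] at hy ⊢
    have h1 := hhalf (x + y ^ 2)
    have h2 := norm_add_le x (y ^ 2)
    have h3 : ‖y ^ 2‖ ≤ ‖y‖ ^ 2 := norm_pow_le' y two_pos
    have h4 : ‖y‖ ^ 2 ≤ (1 / 2) ^ 2 := pow_le_pow_left₀ (norm_nonneg _) hy 2
    change ‖(1 / 2 : ℚ) • (x + y ^ 2)‖ ≤ 1 / 2
    linarith
  have hf : ContractingWith (1 / 2) (hmaps.restrict f _ _) := by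
    refine ⟨by rw [← NNReal.coe_lt_coe]; norm_num, LipschitzWith.of_dist_le_mul ?_⟩
    rintro ⟨y, hy⟩ ⟨z, hz⟩
    rw [mem_closedBall_zero_iff] at hy hz
    rw [Subtype.dist_eq, Subtype.dist_eq, dist_eq_norm, dist_eq_norm]
    change ‖(1 / 2 : ℚ) • (x + y ^ 2) - (1 / 2 : ℚ) • (x + z ^ 2)‖ ≤ _ * ‖y - z‖
    have h1 : (1 / 2 : ℚ) • (x + y ^ 2) - (1 / 2 : ℚ) • (x + z ^ 2) =
        (1 / 2 : ℚ) • ((y + z) * (y - z)) := by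
      rw [← smul_sub]
      congr 1
      ring
    rw [h1]
    refine (hhalf _).trans ?_
    have h2 := norm_mul_le (y + z) (y - z)
    have h3 := norm_add_le y z
    have h4 : ‖y + z‖ * ‖y - z‖ ≤ 1 * ‖y - z‖ :=
      mul_le_mul_of_nonneg_right (by linarith) (norm_nonneg _)
    have h5 : (((1 / 2 : NNReal)) : ℝ) = 1 / 2 := by norm_num
    rw [h5]
    linarith
  obtain ⟨y, -, hy, -⟩ := ContractingWith.exists_fixedPoint'
    Metric.isClosed_closedBall.isComplete hmaps hf
    (Metric.mem_closedBall_self (by norm_num) : (0 : B) ∈ Metric.closedBall 0 (1 / 2))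
    (edist_ne_top _ _)
  have hy' : (1 / 2 : ℚ) • (x + y ^ 2) = y := hy
  have hy2 : x + y ^ 2 = 2 * y := by
    conv_rhs => rw [← hy', Algebra.smul_def, ← mul_assoc]
    rw [← map_ofNat (algebraMap ℚ B) 2, ← map_mul]
    norm_num
  exact ⟨1 - y, by linear_combination -hy2⟩

lemma exists_D_eq_top [CompleteSpace B] (a : B) : ∃ r : ℚ, D (algebraMap ℚ B r + a) = ⊤ := by
  obtain ⟨n, hn⟩ := exists_nat_gt (2 * ‖a‖ + 1)
  have hn1 : (1 : ℝ) < n := by linarith [norm_nonneg a]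
  have hn0 : (n : ℚ) ≠ 0 := by
    rintro h
    have : (n : ℝ) = 0 := by exact_mod_cast h
    linarith
  have hx : ‖-(((n : ℚ) ^ 2)⁻¹ • a)‖ ≤ 1 / 2 := by
    rw [norm_neg]
    refine (norm_smul_le _ _).trans ?_
    have h1 : ‖((n : ℚ) ^ 2)⁻¹‖ = ((n : ℝ) ^ 2)⁻¹ := by
      rw [← Rat.norm_cast_real]
      simp
    rw [h1, inv_mul_le_iff₀ (by positivity)]
    nlinarith
  obtain ⟨y, hy⟩ := exists_sq _ hx
  refine ⟨(n : ℚ) ^ 2 + 1, ?_⟩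
  rw [eq_top_iff, ← isMFnModel_D.one]
  refine D_mono ⟨algebraMap ℚ B n * y, ?_⟩
  have h2 : algebraMap ℚ B n ^ 2 * ((n : ℚ) ^ 2)⁻¹ • a = a := by
    rw [Algebra.smul_def, ← mul_assoc, ← map_pow, ← map_mul, mul_inv_cancel₀ (pow_ne_zero 2 hn0),
      map_one, one_mul]
  rw [map_add, map_pow, map_one]
  linear_combination (algebraMap ℚ B n) ^ 2 * hy - h2

lemma gelfandPreimage_mono (a : B) : Monotone (gelfandPreimage a) := fun _ _ h =>
  iSup_le fun p => le_iSup_of_le ⟨p.1, p.2.trans h⟩ le_rfl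

lemma le_gelfandPreimage (a : B) (U : Opens ℝ) (r s : ℚ) (h : Set.Icc (r : ℝ) s ⊆ U) :
    D (a - algebraMap ℚ B r) ⊓ D (algebraMap ℚ B s - a) ≤ gelfandPreimage a U :=
  le_iSup_of_le ⟨(r, s), h⟩ le_rfl

lemma D_sub_anti {a : B} {r s : ℚ} (h : r ≤ s) :
    D (a - algebraMap ℚ B s) ≤ D (a - algebraMap ℚ B r) := by
  simpa [sub_eq_add_neg] using D_le_of_rat (a := a) (neg_le_neg h)

lemma D_sub_mono {a : B} {r s : ℚ} (h : r ≤ s) :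
    D (algebraMap ℚ B r - a) ≤ D (algebraMap ℚ B s - a) := by
  simpa [sub_eq_neg_add] using D_le_of_rat (a := -a) h

lemma D_inf_eq_bot (a : B) {r s : ℚ} (h : s ≤ r) :
    D (a - algebraMap ℚ B r) ⊓ D (algebraMap ℚ B s - a) = ⊥ := by
  have h1 := isMFnModel_D.inf_neg (a - algebraMap ℚ B r)
  rw [neg_sub] at h1
  exact le_bot_iff.1 ((inf_le_inf_left _ (D_sub_mono h)).trans_eq h1)

lemma gelfandPreimage_cover (a : B) (S : Set (Opens ℝ)) (r s : ℚ)
    (h : Set.Icc (r : ℝ) s ⊆ (sSup S : Opens ℝ)) :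
    D (a - algebraMap ℚ B r) ⊓ D (algebraMap ℚ B s - a) ≤ ⨆ U ∈ S, gelfandPreimage a U := by
  have hc : Set.Icc (r : ℝ) s ⊆ ⋃ U : S, (U : Set ℝ) := by
    intro x hx
    have := h hx
    simpa using this
  obtain ⟨δ, hδ, hball⟩ :=
    lebesgue_number_lemma_of_metric isCompact_Icc (fun U : S => U.1.isOpen) hc
  obtain ⟨ε, hε0, hε⟩ := exists_rat_btwn (half_pos hδ)
  have hε0' : (0 : ℚ) < ε := by exact_mod_cast hε0
  have key : ∀ n : ℕ, ∀ t : ℚ, t ≤ s → t - r ≤ n * ε →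
      D (a - algebraMap ℚ B r) ⊓ D (algebraMap ℚ B t - a) ≤ ⨆ U ∈ S, gelfandPreimage a U := by
    intro n
    induction n with
    | zero =>
      intro t _ ht
      rw [D_inf_eq_bot a (by simpa using ht)]
      exact bot_le
    | succ n ih =>
      intro t hts ht
      rcases le_total t r with htr | hrt
      · rw [D_inf_eq_bot a htr]
        exact bot_le
      · push_cast at ht
        have h1 := ih (t - ε) (by linarith) (by linarith)
        obtain ⟨U, hU⟩ := hball t ⟨by exact_mod_cast hrt, by exact_mod_cast hts⟩
        have h2 : D (a - algebraMap ℚ B (t - 2 * ε)) ⊓ D (algebraMap ℚ B t - a) ≤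
            ⨆ U ∈ S, gelfandPreimage a U := by
          refine (le_gelfandPreimage a U.1 _ _ ?_).trans
            (le_iSup₂ (f := fun U (_ : U ∈ S) => gelfandPreimage a U) U.1 U.2)
          intro x hx
          apply hU
          have hx1 := hx.1
          have hx2 := hx.2
          push_cast at hx1
          rw [Metric.mem_ball, Real.dist_eq, abs_lt]
          constructor <;> linarith
        have h3 : D (algebraMap ℚ B (t - ε) - a) ⊔ D (a - algebraMap ℚ B (t - 2 * ε)) = ⊤ := by
          have h4 := isMFnModel_D.add (algebraMap ℚ B (t - ε) - a)
            (a - algebraMap ℚ B (t - 2 * ε))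
          have h5 : algebraMap ℚ B (t - ε) - a + (a - algebraMap ℚ B (t - 2 * ε)) =
              algebraMap ℚ B ε := by
            rw [sub_add_sub_cancel, ← map_sub]
            congr 1
            ring
          rw [h5, D_pos hε0'] at h4
          exact top_le_iff.1 h4
        rw [← inf_top_eq (D (a - algebraMap ℚ B r) ⊓ D (algebraMap ℚ B t - a)), ← h3, inf_sup_left]
        refine sup_le ((inf_le_inf_right _ inf_le_left).trans h1) (le_trans ?_ h2)
        rw [inf_comm]
        exact inf_le_inf_left _ inf_le_right
  obtain ⟨n, hn⟩ := exists_nat_ge ((s - r) / ε)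
  exact key n s le_rfl ((div_le_iff₀ hε0').1 hn)

lemma gelfandPreimage_Ioo (a : B) (r s : ℚ) :
    gelfandPreimage a ⟨Set.Ioo (r : ℝ) s, isOpen_Ioo⟩ =
      D (a - algebraMap ℚ B r) ⊓ D (algebraMap ℚ B s - a) := by
  apply le_antisymm
  · refine iSup_le fun ⟨⟨p, q⟩, hpq⟩ => ?_
    rcases le_or_gt p q with h | h
    · have hp := (hpq (Set.left_mem_Icc.2 (by exact_mod_cast h))).1
      have hq := (hpq (Set.right_mem_Icc.2 (by exact_mod_cast h))).2
      exact inf_le_inf (D_sub_anti (by exact_mod_cast hp.le)) (D_sub_mono (by exact_mod_cast hq.le))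
    · exact (D_inf_eq_bot a h.le).trans_le bot_le
  · rw [isMFnModel_D.iSup (a - algebraMap ℚ B r), isMFnModel_D.iSup (algebraMap ℚ B s - a),
      iSup_inf_iSup]
    refine iSup_le fun ⟨t, u⟩ => ?_
    have h1 : a - algebraMap ℚ B r - algebraMap ℚ B t = a - algebraMap ℚ B (r + t) := by
      rw [map_add]
      ring
    have h2 : algebraMap ℚ B s - a - algebraMap ℚ B u = algebraMap ℚ B (s - u) - a := by
      rw [map_sub]
      ring
    rw [h1, h2]
    refine le_gelfandPreimage a _ _ _ fun x hx => ?_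
    have ht : (0 : ℝ) < (t : ℚ) := by exact_mod_cast t.2
    have hu : (0 : ℝ) < (u : ℚ) := by exact_mod_cast u.2
    have hx1 := hx.1
    have hx2 := hx.2
    push_cast at hx1 hx2
    exact ⟨by linarith, by linarith⟩

/-- The Gelfand transform `â` of `a`, a map of locales `MFn(B) → ℝ`, that is, a frame
homomorphism from the opens of `ℝ` to `MFn(B)`. -/
def gelfandTransform [CompleteSpace B] (a : B) : FrameHom (Opens ℝ) (MFn B) where
  toFun := gelfandPreimage a
  map_inf' U V := by
    refine le_antisymm
      (le_inf (gelfandPreimage_mono a inf_le_left) (gelfandPreimage_mono a inf_le_right)) ?_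
    change gelfandPreimage a U ⊓ gelfandPreimage a V ≤ _
    rw [gelfandPreimage, gelfandPreimage, iSup_inf_iSup]
    refine iSup_le fun ⟨⟨⟨r, s⟩, h⟩, ⟨⟨r', s'⟩, h'⟩⟩ => ?_
    refine le_trans ?_ (le_gelfandPreimage a (U ⊓ V) (max r r') (min s s') ?_)
    · refine le_inf ?_ ?_
      · rcases max_choice r r' with e | e <;> rw [e]
        · exact inf_le_left.trans inf_le_left
        · exact inf_le_right.trans inf_le_left
      · rcases min_choice s s' with e | e <;> rw [e]
        · exact inf_le_left.trans inf_le_right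
        · exact inf_le_right.trans inf_le_right
    · intro x hx
      have hx1 := hx.1
      have hx2 := hx.2
      push_cast at hx1 hx2
      rw [max_le_iff] at hx1
      rw [le_min_iff] at hx2
      exact ⟨h ⟨hx1.1, hx2.1⟩, h' ⟨hx1.2, hx2.2⟩⟩
  map_top' := by
    obtain ⟨r, hr⟩ := exists_D_eq_top a
    obtain ⟨s, hs⟩ := exists_D_eq_top (-a)
    rw [eq_top_iff]
    refine le_trans (le_of_eq ?_) (le_gelfandPreimage a ⊤ (-r) s fun _ _ => trivial)
    rw [map_neg, sub_neg_eq_add, add_comm, hr, sub_eq_add_neg, hs, inf_top_eq]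
  map_sSup' S := by
    rw [sSup_image]
    exact le_antisymm (iSup_le fun p => gelfandPreimage_cover a S _ _ p.2)
      (iSup₂_le fun U hU => gelfandPreimage_mono a (le_sSup hU))

/-- The upper real `‖â‖`: `‖â‖ < r` iff the inverse image of `(-r, r)` under `â` is the top
element of `MFn(B)`. -/
def gelfandCut [CompleteSpace B] (a : B) : Set ℚ :=
  {r | 0 < r ∧ gelfandTransform a ⟨Set.Ioo ((-r : ℚ) : ℝ) r, isOpen_Ioo⟩ = ⊤}

theorem mem_gelfandCut_iff [CompleteSpace B] (a : B) (r : ℚ) :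
    r ∈ gelfandCut a ↔
      0 < r ∧ D (algebraMap ℚ B r - a) ⊓ D (a + algebraMap ℚ B r) = (⊤ : MFn B) := by
  have h := gelfandPreimage_Ioo a (-r) r
  rw [map_neg, sub_neg_eq_add, inf_comm] at h
  rw [← h]
  rfl

end Transform

end GelfandReal

/-!
All three upper reals are compared through the relation `0 ≪ b`.

*The norm and the squares.* A contraction argument gives a square root of `s - x` whenever `s` is
rational and `‖x‖ < s` (`isSquare_algebraMap_sub`); hence `‖a‖ < r` implies `0 ≪ r - a` and
`0 ≪ r + a`. Conversely, if `r - a = x ^ 2` and `r + a = y ^ 2`, then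
`a ^ 2 + (x * y) ^ 2 = r ^ 2`, and the two hypotheses on the norm give `‖a‖ ≤ r`
(`norm_le_of_isSquare`). The same estimate shows that a sum of squares plus a positive rational is
an invertible square (`isSquare_add_of_isSumSq`).

*The locale.* If `0 ≪ b`, then `D b = ⊤` directly from the relations. The converse
(`wayBelow_of_D_eq_top`) is a Positivstellensatz. If `0 ≪ b` fails, then the cone of the elements
`p - q * b`, with `p` and `q` sums of squares, does not contain `-1`: an equation `q * b = 1 + p`
would make `b` an invertible sum of squares, and so bounded below by a positive rational
(`wayBelow_of_mul_eq_one_add`). By Zorn's lemma this cone lies in a proper cone `T` with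
`T ∪ -T = B` (`Subsemiring.exists_le_total`). The predicate "`a - s ∈ T` for some rational
`s > 0`" satisfies the relations of `MFn(B)` in the frame of propositions
(`isMFnModel_strictlyPos`), and so defines a point of `MFn(B)`. This point is not in `D b`, because
`-b ∈ T`, so `D b ≠ ⊤`. No embedding of `ℝ` into `B` and no real-valued characters are needed.
-/

/-! ### Total cones in a commutative ring -/

namespace Subsemiring

variable {R : Type*} [CommRing R]

/-- The cone `{p + q * a | p, q ∈ P}` obtained by adjoining `a` to a cone `P` that contains all
squares; it is closed under multiplication because `a * a ∈ P`. -/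
def adjoinElement (P : Subsemiring R) (hP : ∀ x, x * x ∈ P) (a : R) : Subsemiring R where
  carrier := {x | ∃ p ∈ P, ∃ q ∈ P, x = p + q * a}
  zero_mem' := ⟨0, zero_mem P, 0, zero_mem P, by ring⟩
  one_mem' := ⟨1, one_mem P, 0, zero_mem P, by ring⟩
  add_mem' := by
    rintro _ _ ⟨p, hp, q, hq, rfl⟩ ⟨p', hp', q', hq', rfl⟩
    exact ⟨p + p', add_mem hp hp', q + q', add_mem hq hq', by ring⟩
  mul_mem' := by
    rintro _ _ ⟨p, hp, q, hq, rfl⟩ ⟨p', hp', q', hq', rfl⟩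
    exact ⟨p * p' + q * q' * (a * a), add_mem (mul_mem hp hp') (mul_mem (mul_mem hq hq') (hP a)),
      p * q' + q * p', add_mem (mul_mem hp hq') (mul_mem hq hp'), by ring⟩

lemma mem_adjoinElement {P : Subsemiring R} {hP : ∀ x, x * x ∈ P} {a x : R} :
    x ∈ P.adjoinElement hP a ↔ ∃ p ∈ P, ∃ q ∈ P, x = p + q * a :=
  Iff.rfl

lemma le_adjoinElement (P : Subsemiring R) (hP : ∀ x, x * x ∈ P) (a : R) :
    P ≤ P.adjoinElement hP a :=
  fun p hp => ⟨p, hp, 0, zero_mem P, by ring⟩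

lemma self_mem_adjoinElement (P : Subsemiring R) (hP : ∀ x, x * x ∈ P) (a : R) :
    a ∈ P.adjoinElement hP a :=
  ⟨0, zero_mem P, 1, one_mem P, by ring⟩

/-- A proper cone stays proper after adjoining one of `a` and `-a`. -/
lemma neg_one_notMem_adjoinElement_or {P : Subsemiring R} (hP : ∀ x, x * x ∈ P)
    (h : (-1 : R) ∉ P) (a : R) :
    -1 ∉ P.adjoinElement hP a ∨ -1 ∉ P.adjoinElement hP (-a) := by
  by_contra! ⟨⟨p, hp, q, hq, e⟩, ⟨p', hp', q', hq', e'⟩⟩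
  refine h ?_
  -- Multiply `q * a = -(1 + p)` by `q' * (-a) = -(1 + p')`.
  have key : (-1 : R) = p + p' + p * p' + q * q' * (a * a) := by
    linear_combination (1 + p') * e - q * a * e'
  rw [key]
  exact add_mem (add_mem (add_mem hp hp') (mul_mem hp hp')) (mul_mem (mul_mem hq hq') (hP a))

/-- By Zorn's lemma, every proper cone containing all squares lies in a total one. -/
theorem exists_le_total {P : Subsemiring R} (hP : ∀ x, x * x ∈ P) (h : (-1 : R) ∉ P) :
    ∃ T : Subsemiring R, P ≤ T ∧ (-1 : R) ∉ T ∧ ∀ x, x ∈ T ∨ -x ∈ T := by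
  obtain ⟨T, hPT, hT⟩ := zorn_le_nonempty₀ {T : Subsemiring R | P ≤ T ∧ (-1 : R) ∉ T} (by
    intro c hc hchain S hS
    refine ⟨sSup c, ⟨(hc hS).1.trans (le_sSup hS), fun hmem => ?_⟩, fun T hT => le_sSup hT⟩
    obtain ⟨T, hT, hmem'⟩ := (mem_sSup_of_directedOn ⟨S, hS⟩ hchain.directedOn).1 hmem
    exact (hc hT).2 hmem') P ⟨le_rfl, h⟩
  have hTsq : ∀ x, x * x ∈ T := fun x => hPT (hP x)
  have hmax : ∀ a, -1 ∉ T.adjoinElement hTsq a → a ∈ T := fun a ha =>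
    hT.2 ⟨hPT.trans (le_adjoinElement T hTsq a), ha⟩ (le_adjoinElement T hTsq a)
      (self_mem_adjoinElement T hTsq a)
  exact ⟨T, hPT, hT.1.2, fun x =>
    (neg_one_notMem_adjoinElement_or hTsq hT.1.2 x).imp (hmax x) (hmax (-x))⟩

end Subsemiring

namespace GelfandReal

universe u

/-! ### The model given by a total cone -/

section Model

variable {B : Type u} [CommRing B] [Algebra ℚ B] {T : Subsemiring B}

lemma algebraMap_mem (hsq : ∀ x, x * x ∈ T) {q : ℚ} (hq : 0 ≤ q) : algebraMap ℚ B q ∈ T := by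
  have h : algebraMap ℚ B q =
      ((q.num.natAbs * q.den : ℕ) : B) * (algebraMap ℚ B (q.den : ℚ)⁻¹ *
        algebraMap ℚ B (q.den : ℚ)⁻¹) := by
    rw [← map_natCast (algebraMap ℚ B), ← map_mul, ← map_mul]
    congr 1
    have h1 : ((q.num.natAbs : ℕ) : ℚ) = q.num := by
      rw [Nat.cast_natAbs, abs_of_nonneg (Rat.num_nonneg.2 hq)]
    have h2 : (q.den : ℚ) ≠ 0 := by exact_mod_cast q.den_ne_zero
    conv_lhs => rw [← Rat.num_div_den q]
    rw [Nat.cast_mul, h1]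
    field_simp
  rw [h]
  exact mul_mem (natCast_mem T _) (hsq _)

lemma algebraMap_notMem (hsq : ∀ x, x * x ∈ T) (hneg : (-1 : B) ∉ T) {q : ℚ} (hq : q < 0) :
    algebraMap ℚ B q ∉ T := by
  intro h
  refine hneg ?_
  have h1 := mul_mem h (algebraMap_mem hsq (q := -q⁻¹) (by simpa using hq.le))
  rwa [← map_mul, mul_neg, mul_inv_cancel₀ hq.ne, map_neg, map_one] at h1

/-- The positivity predicate of a total cone: `a` is bounded below by a positive rational. -/
def StrictlyPos (T : Subsemiring B) (a : B) : Prop :=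
  ∃ s : ℚ, 0 < s ∧ a - algebraMap ℚ B s ∈ T

lemma StrictlyPos.mem (hsq : ∀ x, x * x ∈ T) {a : B} (h : StrictlyPos T a) : a ∈ T := by
  obtain ⟨s, hs, h⟩ := h
  simpa using add_mem h (algebraMap_mem hsq hs.le)

lemma StrictlyPos.mul (hsq : ∀ x, x * x ∈ T) {a b : B} (ha : StrictlyPos T a)
    (hb : StrictlyPos T b) : StrictlyPos T (a * b) := by
  obtain ⟨s, hs, ha⟩ := ha
  obtain ⟨t, ht, hb⟩ := hb
  refine ⟨s * t, mul_pos hs ht, ?_⟩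
  have h := add_mem (add_mem (mul_mem ha hb) (mul_mem (algebraMap_mem hsq hs.le) hb))
    (mul_mem (algebraMap_mem hsq ht.le) ha)
  convert h using 1
  rw [map_mul]
  ring

lemma not_strictlyPos_neg (hsq : ∀ x, x * x ∈ T) (hneg : (-1 : B) ∉ T) {a : B} (ha : a ∈ T) :
    ¬ StrictlyPos T (-a) := by
  rintro ⟨s, hs, h⟩
  refine algebraMap_notMem hsq hneg (neg_lt_zero.2 hs) ?_
  convert add_mem ha h using 1
  rw [map_neg]
  ring

/-- A product of elements of an archimedean total cone is bounded away from `0` only if the first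
factor is: if `a` is smaller than every positive rational, so is `a * b`, as `b` is bounded. -/
lemma StrictlyPos.left_of_mul (hsq : ∀ x, x * x ∈ T) (hneg : (-1 : B) ∉ T)
    (htot : ∀ x, x ∈ T ∨ -x ∈ T) (harch : ∀ x : B, ∃ N : ℚ, 0 < N ∧ algebraMap ℚ B N - x ∈ T)
    {a b : B} (hb : b ∈ T) (hab : StrictlyPos T (a * b)) : StrictlyPos T a := by
  obtain ⟨s, hs, h⟩ := hab
  obtain ⟨N, hN, hNb⟩ := harch b
  have hpos : 0 < s / (2 * N) := by positivity
  refine ⟨s / (2 * N), hpos, (htot _).resolve_right fun h' => ?_⟩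
  refine algebraMap_notMem hsq hneg (q := -(s / 2)) (by linarith) ?_
  have h1 := add_mem (add_mem h (mul_mem h' hb)) (mul_mem (algebraMap_mem hsq hpos.le) hNb)
  convert h1 using 1
  have h2 : algebraMap ℚ B (s / (2 * N)) * algebraMap ℚ B N =
      algebraMap ℚ B s - algebraMap ℚ B (s / 2) := by
    rw [← map_mul, ← map_sub]
    congr 1
    field_simp
    ring
  rw [map_neg]
  linear_combination -h2

/-- An archimedean total cone is a point of `MFn(B)`: its positivity predicate satisfies the
relations of `MFn(B)` in the frame of propositions. -/
theorem isMFnModel_strictlyPos (hsq : ∀ x, x * x ∈ T) (hneg : (-1 : B) ∉ T)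
    (htot : ∀ x, x ∈ T ∨ -x ∈ T)
    (harch : ∀ x : B, ∃ N : ℚ, 0 < N ∧ algebraMap ℚ B N - x ∈ T) :
    IsMFnModel (StrictlyPos T) where
  one := eq_true ⟨1 / 2, by norm_num, by
    have h := algebraMap_mem hsq (q := 1 / 2) (by norm_num)
    rw [← map_one (algebraMap ℚ B), ← map_sub]
    convert h using 2
    norm_num⟩
  neg_sq a := eq_false (not_strictlyPos_neg hsq hneg (by rw [sq]; exact hsq a))
  add a b := by
    rintro ⟨s, hs, h⟩
    rcases htot (a - algebraMap ℚ B (s / 2)) with h' | h'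
    · exact Or.inl ⟨s / 2, half_pos hs, h'⟩
    · refine Or.inr ⟨s / 2, half_pos hs, ?_⟩
      convert add_mem h h' using 1
      have h2 : algebraMap ℚ B s = algebraMap ℚ B (s / 2) + algebraMap ℚ B (s / 2) := by
        rw [← map_add, add_halves]
      rw [h2]
      ring
  inf_neg a := eq_false fun h => not_strictlyPos_neg hsq hneg (h.1.mem hsq) h.2
  mul a b := by
    have hmul : ∀ a b : B, a ∈ T → StrictlyPos T (a * b) → StrictlyPos T a ∧ StrictlyPos T b := by
      intro a b ha hab
      have hb : b ∈ T := (htot b).resolve_right fun h =>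
        not_strictlyPos_neg hsq hneg (mul_mem ha h) (by simpa using hab)
      exact ⟨hab.left_of_mul hsq hneg htot harch hb,
        StrictlyPos.left_of_mul hsq hneg htot harch ha (by rwa [mul_comm])⟩
    refine propext ⟨fun h => ?_, ?_⟩
    · rcases htot a with ha | ha
      · exact Or.inl (hmul a b ha h)
      · exact Or.inr (hmul (-a) (-b) ha (by rwa [neg_mul_neg]))
    · rintro (⟨ha, hb⟩ | ⟨ha, hb⟩)
      · exact ha.mul hsq hb
      · rw [← neg_mul_neg]
        exact ha.mul hsq hb
  iSup a := by
    rw [iSup_Prop_eq]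
    refine propext ⟨?_, ?_⟩
    · rintro ⟨s, hs, h⟩
      refine ⟨⟨s / 2, half_pos hs⟩, s / 2, half_pos hs, ?_⟩
      rwa [sub_sub, ← map_add, add_halves]
    · rintro ⟨⟨r, hr⟩, s, hs, h⟩
      refine ⟨r + s, add_pos hr hs, ?_⟩
      rwa [map_add, ← sub_sub]

end Model

/-! ### Squares and the norm -/

lemma norm_one_le_one {B : Type u} [NormedCommRing B]
    (hsq : ∀ a : B, ‖a ^ 2‖ = ‖a‖ ^ 2) : ‖(1 : B)‖ ≤ 1 := by
  have h := hsq 1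
  rw [one_pow] at h
  nlinarith [norm_nonneg (1 : B)]

section Norm

variable {B : Type u} [NormedCommRing B] [NormedAlgebra ℚ B]

lemma norm_ratCast_smul_le (q : ℚ) (b : B) : ‖q • b‖ ≤ |(q : ℝ)| * ‖b‖ := by
  refine (norm_smul_le q b).trans_eq ?_
  rw [← Rat.norm_cast_real, Real.norm_eq_abs]

lemma algebraMap_mul_algebraMap_inv {q : ℚ} (hq : q ≠ 0) :
    algebraMap ℚ B q * algebraMap ℚ B q⁻¹ = 1 := by
  rw [← map_mul, mul_inv_cancel₀ hq, map_one]

/-- The iteration `y ↦ (x + y ^ 2) / 2`, whose fixed point gives the root `1 - y` of `1 - x`,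
contracts the ball of radius `‖x‖`, since `‖x‖ + ‖x‖ ^ 2 ≤ 2 * ‖x‖` when `‖x‖ < 1`. -/
lemma isSquare_one_sub [CompleteSpace B] (x : B) (h : ‖x‖ < 1) : IsSquare (1 - x) := by
  have hhalf : ∀ b : B, ‖(1 / 2 : ℚ) • b‖ ≤ 1 / 2 * ‖b‖ := fun b => by
    refine (norm_ratCast_smul_le _ _).trans_eq ?_
    norm_num
  have h0 := norm_nonneg x
  let f : B → B := fun y => (1 / 2 : ℚ) • (x + y ^ 2)
  have hmaps : Set.MapsTo f (Metric.closedBall 0 ‖x‖) (Metric.closedBall 0 ‖x‖) := by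
    intro y hy
    rw [mem_closedBall_zero_iff] at hy ⊢
    have h1 := hhalf (x + y ^ 2)
    have h2 := norm_add_le x (y ^ 2)
    have h3 : ‖y ^ 2‖ ≤ ‖y‖ ^ 2 := norm_pow_le' y two_pos
    have h4 : ‖y‖ ^ 2 ≤ ‖x‖ ^ 2 := pow_le_pow_left₀ (norm_nonneg _) hy 2
    change ‖(1 / 2 : ℚ) • (x + y ^ 2)‖ ≤ ‖x‖
    nlinarith
  have hf : ContractingWith ‖x‖₊ (hmaps.restrict f _ _) := by
    refine ⟨h, LipschitzWith.of_dist_le_mul ?_⟩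
    rintro ⟨y, hy⟩ ⟨z, hz⟩
    rw [mem_closedBall_zero_iff] at hy hz
    rw [Subtype.dist_eq, Subtype.dist_eq, dist_eq_norm, dist_eq_norm]
    change ‖(1 / 2 : ℚ) • (x + y ^ 2) - (1 / 2 : ℚ) • (x + z ^ 2)‖ ≤ ‖x‖ * ‖y - z‖
    have h1 : (1 / 2 : ℚ) • (x + y ^ 2) - (1 / 2 : ℚ) • (x + z ^ 2) =
        (1 / 2 : ℚ) • ((y + z) * (y - z)) := by
      rw [← smul_sub]
      congr 1
      ring
    rw [h1]
    refine (hhalf _).trans ?_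
    have h2 := norm_mul_le (y + z) (y - z)
    have h3 := norm_add_le y z
    have h4 : ‖y + z‖ * ‖y - z‖ ≤ (2 * ‖x‖) * ‖y - z‖ :=
      mul_le_mul_of_nonneg_right (by linarith) (norm_nonneg _)
    linarith
  obtain ⟨y, -, hy, -⟩ := ContractingWith.exists_fixedPoint'
    Metric.isClosed_closedBall.isComplete hmaps hf
    (Metric.mem_closedBall_self h0 : (0 : B) ∈ Metric.closedBall 0 ‖x‖)
    (edist_ne_top _ _)
  have hy' : (1 / 2 : ℚ) • (x + y ^ 2) = y := hy
  have hy2 : x + y ^ 2 = 2 * y := by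
    conv_rhs => rw [← hy', Algebra.smul_def, ← mul_assoc]
    rw [← map_ofNat (algebraMap ℚ B) 2, ← map_mul]
    norm_num
  exact ⟨1 - y, by linear_combination -hy2⟩

lemma norm_inv_smul_lt_one {x : B} {s : ℚ} (h : ‖x‖ < s) : ‖s⁻¹ • x‖ < 1 := by
  have hs : (0 : ℝ) < s := (norm_nonneg x).trans_lt h
  refine (norm_ratCast_smul_le _ _).trans_lt ?_
  rw [Rat.cast_inv, abs_of_pos (inv_pos.2 hs), inv_mul_lt_iff₀ hs, mul_one]
  exact h

lemma algebraMap_sub_eq_mul {s : ℚ} (hs : s ≠ 0) (x : B) :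
    algebraMap ℚ B s - x = algebraMap ℚ B s * (1 - s⁻¹ • x) := by
  rw [Algebra.smul_def]
  linear_combination x * algebraMap_mul_algebraMap_inv (B := B) hs

lemma norm_algebraMap_le (h1 : ‖(1 : B)‖ ≤ 1) (q : ℚ) : ‖algebraMap ℚ B q‖ ≤ |(q : ℝ)| := by
  rw [Algebra.algebraMap_eq_smul_one]
  exact (norm_ratCast_smul_le q 1).trans (mul_le_of_le_one_right (abs_nonneg _) h1)

lemma isSquare_algebraMap_sub [CompleteSpace B] (h1 : ‖(1 : B)‖ ≤ 1) {x : B} {s : ℚ}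
    (h : ‖x‖ < s) : IsSquare (algebraMap ℚ B s - x) := by
  have hs : (0 : ℝ) < s := (norm_nonneg x).trans_lt h
  have hs' : (0 : ℚ) < s := by exact_mod_cast hs
  -- As `s` need not be a rational square, `s - x` is written as `t ^ 2 - (x + (t ^ 2 - s))` with
  -- `t ^ 2 > s`; here `t = s + 1`.
  have hlt : s < (s + 1) * (s + 1) := by nlinarith
  have hlt' : (s : ℝ) < ((s + 1) * (s + 1) : ℚ) := by exact_mod_cast hlt
  have hnorm : ‖x + algebraMap ℚ B ((s + 1) * (s + 1) - s)‖ < ((s + 1) * (s + 1) : ℚ) := by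
    refine (norm_add_le _ _).trans_lt ?_
    have h2 := norm_algebraMap_le h1 ((s + 1) * (s + 1) - s)
    rw [Rat.cast_sub, abs_of_pos (sub_pos.2 hlt')] at h2
    linarith
  have h3 : algebraMap ℚ B s - x = algebraMap ℚ B ((s + 1) * (s + 1)) -
      (x + algebraMap ℚ B ((s + 1) * (s + 1) - s)) := by
    rw [map_sub]
    ring
  rw [h3, algebraMap_sub_eq_mul (hs'.trans hlt).ne']
  refine IsSquare.mul ⟨algebraMap ℚ B (s + 1), map_mul _ _ _⟩ ?_
  exact isSquare_one_sub _ (norm_inv_smul_lt_one hnorm)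

lemma isSquare_algebraMap [CompleteSpace B] (h1 : ‖(1 : B)‖ ≤ 1) {s : ℚ} (hs : 0 < s) :
    IsSquare (algebraMap ℚ B s) := by
  simpa using isSquare_algebraMap_sub h1 (x := (0 : B)) (s := s) (by simpa using hs)

lemma isUnit_algebraMap_sub [CompleteSpace B] {x : B} {s : ℚ} (h : ‖x‖ < s) :
    IsUnit (algebraMap ℚ B s - x) := by
  have hs : s ≠ 0 := by
    rintro rfl
    exact (norm_nonneg x).not_gt (by simpa using h)
  rw [algebraMap_sub_eq_mul hs]
  exact (IsUnit.of_mul_eq_one _ (algebraMap_mul_algebraMap_inv hs)).mul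
    (isUnit_one_sub_of_norm_lt_one (norm_inv_smul_lt_one h))

/-- If `r - z` and `r + z` are squares `x ^ 2` and `y ^ 2`, then
`r ^ 2 = z ^ 2 + (x * y) ^ 2`, so the norm of `z` is at most `r`. -/
lemma norm_le_of_isSquare (hsq : ∀ a : B, ‖a ^ 2‖ = ‖a‖ ^ 2)
    (hadd : ∀ a b : B, ‖a ^ 2‖ ≤ ‖a ^ 2 + b ^ 2‖) {r : ℚ} (hr : 0 ≤ r) {z : B}
    (hx : IsSquare (algebraMap ℚ B r - z)) (hy : IsSquare (algebraMap ℚ B r + z)) :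
    ‖z‖ ≤ r := by
  obtain ⟨x, hx⟩ := hx
  obtain ⟨y, hy⟩ := hy
  have h := hadd z (x * y)
  have e : z ^ 2 + (x * y) ^ 2 = algebraMap ℚ B r ^ 2 := by
    linear_combination -(algebraMap ℚ B r + z) * hx - x * x * hy
  rw [e, hsq, hsq] at h
  have hr' : (0 : ℝ) ≤ r := by exact_mod_cast hr
  have h2 := norm_algebraMap_le (norm_one_le_one hsq) r
  rw [abs_of_nonneg hr'] at h2
  exact (pow_le_pow_iff_left₀ (norm_nonneg _) (norm_nonneg _) two_ne_zero).1 h |>.trans h2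

/-- The norm form of nonnegativity, which unlike being a square is visibly preserved by sums. -/
lemma exists_norm_sub_le_of_isSumSq [CompleteSpace B] (hsq : ∀ a : B, ‖a ^ 2‖ = ‖a‖ ^ 2)
    (hadd : ∀ a b : B, ‖a ^ 2‖ ≤ ‖a ^ 2 + b ^ 2‖) {x : B} (hx : IsSumSq x) :
    ∃ M : ℚ, ‖algebraMap ℚ B M - x‖ ≤ M := by
  induction hx with
  | zero => exact ⟨0, by simp⟩
  | sq_add y _ ih =>
    obtain ⟨M, h⟩ := ih
    obtain ⟨N, hN⟩ := exists_rat_gt ‖y * y‖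
    have hN0 : (0 : ℚ) ≤ N := by exact_mod_cast (norm_nonneg _).trans hN.le
    have hNN : algebraMap ℚ B N = algebraMap ℚ B (N / 2) + algebraMap ℚ B (N / 2) := by
      rw [← map_add, add_halves]
    have hy : ‖algebraMap ℚ B (N / 2) - y * y‖ ≤ (N / 2 : ℚ) := by
      refine norm_le_of_isSquare hsq hadd (by positivity) ⟨y, by ring⟩ ?_
      rw [← add_sub_assoc, ← hNN]
      exact isSquare_algebraMap_sub (norm_one_le_one hsq) hN
    refine ⟨N / 2 + M, ?_⟩
    rw [map_add, add_sub_add_comm, Rat.cast_add]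
    exact (norm_add_le _ _).trans (add_le_add hy h)

lemma isSquare_add_of_isSumSq [CompleteSpace B] (hsq : ∀ a : B, ‖a ^ 2‖ = ‖a‖ ^ 2)
    (hadd : ∀ a b : B, ‖a ^ 2‖ ≤ ‖a ^ 2 + b ^ 2‖) {x : B} (hx : IsSumSq x) {c : ℚ} (hc : 0 < c) :
    IsSquare (x + algebraMap ℚ B c) ∧ IsUnit (x + algebraMap ℚ B c) := by
  obtain ⟨M, h⟩ := exists_norm_sub_le_of_isSumSq hsq hadd hx
  have hc' : (0 : ℝ) < c := by exact_mod_cast hc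
  have h2 : ‖algebraMap ℚ B M - x‖ < (M + c : ℚ) := by
    push_cast
    linarith
  have e : x + algebraMap ℚ B c = algebraMap ℚ B (M + c) - (algebraMap ℚ B M - x) := by
    rw [map_add]
    ring
  rw [e]
  exact ⟨isSquare_algebraMap_sub (norm_one_le_one hsq) h2, isUnit_algebraMap_sub h2⟩

lemma WayBelow.of_isSumSq [CompleteSpace B] (hsq : ∀ a : B, ‖a ^ 2‖ = ‖a‖ ^ 2)
    (hadd : ∀ a b : B, ‖a ^ 2‖ ≤ ‖a ^ 2 + b ^ 2‖) {a : B} {r s : ℚ} (hrs : r < s)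
    (h : IsSumSq (a - algebraMap ℚ B s)) : WayBelow r a := by
  obtain ⟨t, hrt, hts⟩ := exists_between hrs
  refine ⟨t, hrt, ?_⟩
  convert (isSquare_add_of_isSumSq hsq hadd h (sub_pos.2 hts)).1 using 1
  rw [map_sub]
  ring

end Norm

/-! ### The two equalities of upper reals -/

lemma isNonnegUpperReal_normCut {B : Type u} [NormedCommRing B] (a : B) :
    IsNonnegUpperReal (normCut a) where
  pos _ h := h.1
  nonempty := by
    obtain ⟨r, hr⟩ := exists_rat_gt ‖a‖
    exact ⟨r, by exact_mod_cast (norm_nonneg a).trans_lt hr, hr⟩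
  upward _ h _ hrs := ⟨h.1.trans_le hrs, h.2.trans_le (by exact_mod_cast hrs)⟩
  isOpen r h := by
    obtain ⟨s, hs, hsr⟩ := exists_rat_btwn h.2
    exact ⟨s, ⟨by exact_mod_cast (norm_nonneg a).trans_lt hs, hs⟩, by exact_mod_cast hsr⟩

section Cuts

variable {B : Type u} [NormedCommRing B] [NormedAlgebra ℚ B]

lemma wayBelow_algebraMap_sub [CompleteSpace B] (h1 : ‖(1 : B)‖ ≤ 1) {a : B} {r : ℚ}
    (h : ‖a‖ < r) : WayBelow 0 (algebraMap ℚ B r - a) := by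
  obtain ⟨s, hs, hsr⟩ := exists_rat_btwn h
  refine ⟨r - s, sub_pos.2 (by exact_mod_cast hsr), ?_⟩
  convert isSquare_algebraMap_sub h1 hs using 1
  rw [map_sub]
  ring

theorem orderUnitCut_eq_normCut [CompleteSpace B] (hsq : ∀ a : B, ‖a ^ 2‖ = ‖a‖ ^ 2)
    (hadd : ∀ a b : B, ‖a ^ 2‖ ≤ ‖a ^ 2 + b ^ 2‖) (a : B) : orderUnitCut a = normCut a := by
  ext r
  refine and_congr_right fun hr => ⟨?_, fun h => ⟨?_, ?_⟩⟩
  · rintro ⟨⟨s, hs, hx⟩, ⟨t, ht, hy⟩⟩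
    -- Squares persist when the rational subtracted is lowered, so one `u` serves both sides.
    obtain ⟨u, hu0, hu⟩ := exists_between (lt_min hr (lt_min hs ht))
    rw [lt_min_iff, lt_min_iff] at hu
    have hlower : ∀ {b : B} {v : ℚ}, u < v → IsSquare (b - algebraMap ℚ B v) →
        IsSquare (b - algebraMap ℚ B u) := by
      intro b v huv hb
      convert (isSquare_add_of_isSumSq hsq hadd hb.isSumSq (sub_pos.2 huv)).1 using 1
      rw [map_sub]
      ring
    have hle : ‖a‖ ≤ (r - u : ℚ) := by
      refine norm_le_of_isSquare hsq hadd (sub_nonneg.2 hu.1.le) ?_ ?_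
      · convert hlower hu.2.1 hx using 1
        rw [map_sub]
        ring
      · convert hlower hu.2.2 hy using 1
        rw [map_sub]
        ring
    exact hle.trans_lt (by exact_mod_cast sub_lt_self r hu0)
  · exact wayBelow_algebraMap_sub (norm_one_le_one hsq) h
  · simpa using wayBelow_algebraMap_sub (norm_one_le_one hsq) (a := -a) (by rwa [norm_neg])

lemma D_eq_top_of_wayBelow {b : B} (h : WayBelow 0 b) : D b = ⊤ := by
  obtain ⟨s, hs, h⟩ := h
  exact top_le_iff.1 ((D_pos hs).ge.trans (D_mono h))

/-- If `q * b = 1 + p` for sums of squares `p` and `q`, then `b` is bounded below by a positive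
rational: `1 + p` is an invertible square, so `b = q * b ^ 2 / (1 + p)` is an invertible sum of
squares, and `K * b - 1 = b * (K - b⁻¹)` is a sum of squares for `K > ‖b⁻¹‖`. -/
lemma wayBelow_of_mul_eq_one_add [CompleteSpace B] (hsq : ∀ a : B, ‖a ^ 2‖ = ‖a‖ ^ 2)
    (hadd : ∀ a b : B, ‖a ^ 2‖ ≤ ‖a ^ 2 + b ^ 2‖) {b p q : B} (hp : IsSumSq p) (hq : IsSumSq q)
    (h : q * b = 1 + p) : WayBelow 0 b := by
  obtain ⟨⟨w, hw⟩, hunit⟩ := isSquare_add_of_isSumSq hsq hadd hp one_pos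
  obtain ⟨v, hv⟩ := hunit.exists_right_inv
  rw [map_one] at hw hv
  have hb : IsSumSq b := by
    have e : b = q * ((b * w * v) * (b * w * v)) := by
      linear_combination (-b - b * (p + 1) * v) * hv + q * b ^ 2 * v ^ 2 * hw -
        b * (p + 1) * v ^ 2 * h
    rw [e]
    exact hq.mul (IsSumSq.mul_self _)
  have hbinv : b * (q * v) = 1 := by linear_combination v * h + hv
  obtain ⟨K, hK⟩ := exists_rat_gt ‖q * v‖
  have hK0 : 0 < K := by exact_mod_cast (norm_nonneg _).trans_lt hK
  have h1 := norm_one_le_one hsq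
  refine WayBelow.of_isSumSq hsq hadd (inv_pos.2 hK0) ?_
  have e : b - algebraMap ℚ B K⁻¹ = algebraMap ℚ B K⁻¹ * (b * (algebraMap ℚ B K - q * v)) := by
    linear_combination -b * algebraMap_mul_algebraMap_inv (B := B) hK0.ne' +
      algebraMap ℚ B K⁻¹ * hbinv
  rw [e]
  exact (isSquare_algebraMap h1 (inv_pos.2 hK0)).isSumSq.mul
    (hb.mul (isSquare_algebraMap_sub h1 hK).isSumSq)

/-- The Positivstellensatz behind the Gelfand transform: if `b` is not bounded below by a positive
rational, then some point of `MFn(B)`, given by a total cone containing `-b`, lies outside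
`D b`. -/
theorem wayBelow_of_D_eq_top [CompleteSpace B] (hsq : ∀ a : B, ‖a ^ 2‖ = ‖a‖ ^ 2)
    (hadd : ∀ a b : B, ‖a ^ 2‖ ≤ ‖a ^ 2 + b ^ 2‖) {b : B} (h : D b = ⊤) : WayBelow 0 b := by
  by_contra hb
  have hS : ∀ x : B, x * x ∈ Subsemiring.sumSq B := fun x =>
    Subsemiring.mem_sumSq.2 (IsSumSq.mul_self x)
  have hproper : -1 ∉ (Subsemiring.sumSq B).adjoinElement hS (-b) := by
    rintro ⟨p, hp, q, hq, e⟩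
    exact hb (wayBelow_of_mul_eq_one_add hsq hadd (Subsemiring.mem_sumSq.1 hp)
      (Subsemiring.mem_sumSq.1 hq) (by linear_combination e))
  obtain ⟨T, hST, hneg, htot⟩ := Subsemiring.exists_le_total
    (fun x => Subsemiring.le_adjoinElement _ hS (-b) (hS x)) hproper
  have hTsq : ∀ x, x * x ∈ T := fun x => hST (Subsemiring.le_adjoinElement _ hS (-b) (hS x))
  have harch : ∀ x : B, ∃ N : ℚ, 0 < N ∧ algebraMap ℚ B N - x ∈ T := by
    intro x
    obtain ⟨N, hN⟩ := exists_rat_gt ‖x‖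
    obtain ⟨y, hy⟩ := isSquare_algebraMap_sub (norm_one_le_one hsq) hN
    exact ⟨N, by exact_mod_cast (norm_nonneg x).trans_lt hN, hy ▸ hTsq y⟩
  obtain ⟨f, hf, -⟩ := existsUnique_frameHom (isMFnModel_strictlyPos hTsq hneg htot harch)
  have hpos : StrictlyPos T b := by
    have h2 := hf b
    rw [h, map_top] at h2
    exact of_eq_true h2.symm
  refine not_strictlyPos_neg hTsq hneg (a := -b)
    (hST (Subsemiring.self_mem_adjoinElement _ hS (-b))) ?_
  rwa [neg_neg]

theorem orderUnitCut_eq_gelfandCut [CompleteSpace B] (hsq : ∀ a : B, ‖a ^ 2‖ = ‖a‖ ^ 2)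
    (hadd : ∀ a b : B, ‖a ^ 2‖ ≤ ‖a ^ 2 + b ^ 2‖) (a : B) : orderUnitCut a = gelfandCut a := by
  ext r
  rw [mem_gelfandCut_iff, inf_eq_top_iff, add_comm a]
  exact and_congr_right fun _ => and_congr
    ⟨D_eq_top_of_wayBelow, wayBelow_of_D_eq_top hsq hadd⟩
    ⟨D_eq_top_of_wayBelow, wayBelow_of_D_eq_top hsq hadd⟩

end Cuts

end GelfandReal

/-- The Gelfand transform is norm-preserving: `‖a‖₀ = ‖a‖ = ‖â‖` as upper reals. -/
theorem theorem4p8 {B : Type*} [NormedCommRing B] [NormedAlgebra ℚ B] [CompleteSpace B]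
    (hsq : ∀ a : B, ‖a ^ 2‖ = ‖a‖ ^ 2)
    (hadd : ∀ a b : B, ‖a ^ 2‖ ≤ ‖a ^ 2 + b ^ 2‖) (a : B) :
    GelfandReal.IsNonnegUpperReal (GelfandReal.orderUnitCut a) ∧
    GelfandReal.IsNonnegUpperReal (GelfandReal.gelfandCut a) ∧
    GelfandReal.orderUnitCut a = GelfandReal.normCut a ∧
    GelfandReal.normCut a = GelfandReal.gelfandCut a := by
  have h1 := GelfandReal.orderUnitCut_eq_normCut hsq hadd a
  have h2 := h1.symm.trans (GelfandReal.orderUnitCut_eq_gelfandCut hsq hadd a)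
  have h3 := GelfandReal.isNonnegUpperReal_normCut a
  exact ⟨h1 ▸ h3, h2 ▸ h3, h1, h2⟩
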